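/- Lemma (Coercivity of the adjoint bilinear form). Let $x_{\max}>0$, $\epsilon>0$, and $\Omega=(-x_{\max},x_{\max})\times(-1,1)$ with points $(x,v)$. Put $$\Gamma^-=\{-x_{\max}\}\times[0,1)\,\cup\,\{x_{\max}\}\times(-1,0],\qquad \Gamma^+=\{-x_{\max}\}\times(-1,0)\,\cup\,\{x_{\max}\}\times(0,1),$$ $$\Gamma_0=(-x_{\max},x_{\max})\times\{\pm1\},\qquad \Gamma_0^+=\Gamma^+\cup\Gamma_0.$$ Let $M=\begin{pmatrix}M_{11}&M_{12}\\M_{12}&M_{22}\end{pmatrix}$ be a real symmetric non-negative definite matrix with non-negative entries such that $4\epsilon M_{12}>M_{22}^2$, let $N=\begin{pmatrix}M_{12}&M_{22}/2\\M_{22}/2&\epsilon\end{pmatrix}$, and let $\lambda_-(\cdot)$ denote the minimum eigenvalue. For $w\in H^1(\Omega)$ let $\mathcal Hw=(w,\sqrt M\,\nabla w)\in L^2(\Omega;\mathbb R^3)$. Let $$H^2_{0,\Gamma_0^+}(\Omega)=\{w\in H^2(\Omega):\ \mathcal Hw=0\text{ on }\Gamma_0^+\text{ in the sense of traces}\},\qquad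 \|\mathcal Hw\|_{\Gamma^-}^2=\int_{\Gamma^-}|\mathcal Hw|^2\,|v|\,ds,$$ where $ds$ is the arc-length measure, and define, with $(\cdot,\cdot)$ the $L^2(\Omega)$ inner product, $$a^*(z,\psi)=-(v\,\mathcal Hz_x,\mathcal H\psi)+(M_{12}z_x+M_{22}z_v,\psi_x)+\epsilon(z_v,\psi_v)+\epsilon(\nabla z_v,M\nabla\psi_v).$$ Then $\lambda_-(N)>0$, and for every $z\in H^2_{0,\Gamma_0^+}(\Omega)$ $$a^*(z,z)\ \ge\ \tfrac12\|\mathcal Hz\|_{\Gamma^-}^2+\lambda_-(N)\,\|\nabla z\|_{L^2(\Omega)}^2+\epsilon\,\lambda_-(M)\,\|\nabla z_v\|_{L^2(\Omega)}^2 .$$ -/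

import Mathlib

namespace Kolmogorov

open MeasureTheory Set Filter Topology Matrix
open scoped ENNReal ContDiff

noncomputable section

/-! Points of the position-velocity plane are pairs `p = (x, v)`, so `x = p.1`, `v = p.2`.
The index `0 : Fin 2` is the `x` direction, the index `1 : Fin 2` the `v` direction. -/

/-- The domain `Ω = (-X, X) × (-1, 1)`. -/
def domain (X : ℝ) : Set (ℝ × ℝ) := Ioo (-X) X ×ˢ Ioo (-1) 1

/-- The inflow boundary. -/
def inflow (X : ℝ) : Set (ℝ × ℝ) := {-X} ×ˢ Ico 0 1 ∪ {X} ×ˢ Ioc (-1) 0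

/-- The outflow boundary. -/
def outflow (X : ℝ) : Set (ℝ × ℝ) := {-X} ×ˢ Ioo (-1) 0 ∪ {X} ×ˢ Ioo 0 1

/-- The parabolic boundary. -/
def parabolic (X : ℝ) : Set (ℝ × ℝ) := Ioo (-X) X ×ˢ {-1, 1}

/-- Lebesgue measure on the domain. -/
def domainMeasure (X : ℝ) : Measure (ℝ × ℝ) := volume.restrict (domain X)

/-- The arc-length measure on the boundary of the rectangle, side by side (the four corners are
null sets). -/
def boundaryMeasure (X : ℝ) : Measure (ℝ × ℝ) :=
  (volume.restrict (Ioo (-1) 1)).map (fun v : ℝ => (-X, v)) +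
  (volume.restrict (Ioo (-1) 1)).map (fun v : ℝ => (X, v)) +
  (volume.restrict (Ioo (-X) X)).map (fun x : ℝ => (x, -1)) +
  (volume.restrict (Ioo (-X) X)).map (fun x : ℝ => (x, 1))

/-- The classical partial derivative in the coordinate direction `i`. -/
def classicalD (i : Fin 2) (φ : ℝ × ℝ → ℝ) (p : ℝ × ℝ) : ℝ :=
  fderiv ℝ φ p ((![(1, 0), (0, 1)] : Fin 2 → ℝ × ℝ) i)

/-- `w'` is a weak `i`-th partial derivative of `w` on the domain. -/
def HasWeakDeriv (X : ℝ) (i : Fin 2) (w w' : ℝ × ℝ → ℝ) : Prop :=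
  LocallyIntegrableOn w (domain X) ∧ LocallyIntegrableOn w' (domain X) ∧
  ∀ φ : ℝ × ℝ → ℝ, ContDiff ℝ ∞ φ → HasCompactSupport φ → tsupport φ ⊆ domain X →
    ∫ p in domain X, w p * classicalD i φ p = -∫ p in domain X, w' p * φ p

open Classical in
/-- The weak `i`-th partial derivative of `w` (unique up to null sets), `0` if there is none. -/
def weakD (X : ℝ) (i : Fin 2) (w : ℝ × ℝ → ℝ) : ℝ × ℝ → ℝ :=
  if h : ∃ w', HasWeakDeriv X i w w' then h.choose else 0

/-- Membership in the Sobolev space `H^m(Ω)`: `w` is in `L²(Ω)`, and for `m ≥ 1` its weak first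
partial derivatives exist and are in `H^(m-1)(Ω)`. -/
def MemSobolev (X : ℝ) : ℕ → (ℝ × ℝ → ℝ) → Prop
  | 0, w => MemLp w 2 (domainMeasure X)
  | m + 1, w => MemLp w 2 (domainMeasure X) ∧
      ∀ i : Fin 2, (∃ w', HasWeakDeriv X i w w') ∧ MemSobolev X m (weakD X i w)

/-- The weak gradient `(w_x, w_v)`. -/
def grad (X : ℝ) (w : ℝ × ℝ → ℝ) (p : ℝ × ℝ) : Fin 2 → ℝ := fun i => weakD X i w p

/-- `g` is the trace on `∂Ω` of the `H¹(Ω)` function `w`: there are functions that are smooth up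
to the boundary, converge to `w` in `H¹(Ω)`, and whose boundary values converge to `g` in
`L²(∂Ω)`. -/
def HasTrace (X : ℝ) (w g : ℝ × ℝ → ℝ) : Prop :=
  MemSobolev X 1 w ∧ MemLp g 2 (boundaryMeasure X) ∧
  ∃ φ : ℕ → ℝ × ℝ → ℝ, (∀ n, ContDiff ℝ ∞ (φ n)) ∧
    Tendsto (fun n => eLpNorm (φ n - w) 2 (domainMeasure X)) atTop (𝓝 0) ∧
    (∀ i, Tendsto (fun n => eLpNorm (classicalD i (φ n) - weakD X i w) 2 (domainMeasure X))
      atTop (𝓝 0)) ∧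
    Tendsto (fun n => eLpNorm (φ n - g) 2 (boundaryMeasure X)) atTop (𝓝 0)

open Classical in
/-- The trace of an `H¹(Ω)` function on `∂Ω` (unique up to null sets). -/
def trace (X : ℝ) (w : ℝ × ℝ → ℝ) : ℝ × ℝ → ℝ :=
  if h : ∃ g, HasTrace X w g then h.choose else 0

/-- `w = 0` on the part `Γ` of the boundary, in the sense of traces. -/
def VanishesOn (X : ℝ) (Γ : Set (ℝ × ℝ)) (w : ℝ × ℝ → ℝ) : Prop :=
  ∃ g, HasTrace X w g ∧ ∀ᵐ p ∂(boundaryMeasure X).restrict Γ, g p = 0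

open scoped MatrixOrder in
/-- The operator `ℋ w = (w, √M ∇w)`, with values in `ℝ³`. -/
def hypo (X : ℝ) (M : Matrix (Fin 2) (Fin 2) ℝ) (w : ℝ × ℝ → ℝ) (p : ℝ × ℝ) : Fin 3 → ℝ :=
  vecCons (w p) (CFC.sqrt M *ᵥ grad X w p)

/-- The space of all `w` in `H²(Ω)` with `ℋ w = 0` on the part `Γ` of the boundary. -/
def H2Zero (X : ℝ) (M : Matrix (Fin 2) (Fin 2) ℝ) (Γ : Set (ℝ × ℝ)) : Set (ℝ × ℝ → ℝ) :=
  {w | MemSobolev X 2 w ∧ ∀ j : Fin 3, VanishesOn X Γ (fun p => hypo X M w p j)}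

/-- The squared norm of `L²(Ω; ℝᵏ)`. -/
def normSq {k : ℕ} (X : ℝ) (f : ℝ × ℝ → Fin k → ℝ) : ℝ :=
  ∫ p in domain X, f p ⬝ᵥ f p

/-- The squared norm of `ℋ w` on the part `Γ` of the boundary, with the weight `|v|`. -/
def hypoBoundaryNormSq (X : ℝ) (M : Matrix (Fin 2) (Fin 2) ℝ) (Γ : Set (ℝ × ℝ))
    (w : ℝ × ℝ → ℝ) : ℝ :=
  ∫ p in Γ, (∑ j : Fin 3, trace X (fun q => hypo X M w q j) p ^ 2) * |p.2| ∂boundaryMeasure X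

/-- The minimum eigenvalue of a (symmetric) matrix. -/
def minEigenvalue (A : Matrix (Fin 2) (Fin 2) ℝ) : ℝ := sInf (spectrum ℝ A)

/-- The matrix `N`. -/
def matN (ε : ℝ) (M : Matrix (Fin 2) (Fin 2) ℝ) : Matrix (Fin 2) (Fin 2) ℝ :=
  !![M 0 1, M 1 1 / 2; M 1 1 / 2, ε]

/-- The adjoint bilinear form
`a*(z, ψ) = -(v ℋ z_x, ℋ ψ) + (M₁₂ z_x + M₂₂ z_v, ψ_x) + ε (z_v, ψ_v) + ε (∇z_v, M ∇ψ_v)`. -/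
def adjointForm (X ε : ℝ) (M : Matrix (Fin 2) (Fin 2) ℝ) (z ψ : ℝ × ℝ → ℝ) : ℝ :=
  -(∫ p in domain X, p.2 * (hypo X M (weakD X 0 z) p ⬝ᵥ hypo X M ψ p))
  + (∫ p in domain X, (M 0 1 * weakD X 0 z p + M 1 1 * weakD X 1 z p) * weakD X 0 ψ p)
  + ε * (∫ p in domain X, weakD X 1 z p * weakD X 1 ψ p)
  + ε * (∫ p in domain X, grad X (weakD X 1 z) p ⬝ᵥ (M *ᵥ grad X (weakD X 1 ψ) p))

end

end Kolmogorov

namespace Kolmogorov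

open MeasureTheory Set Filter Topology Matrix
open scoped ENNReal ContDiff

/-! Put `ψ = z`. Weak derivatives commute, so `ℋ z_x = (ℋ z)_x`, and as `v` does not depend on `x`,
the transport integrand is half the `x`-derivative of `v |ℋ z|²`. Green's formula leaves the sides
`x = ±X`; there the outflow part vanishes, and on the inflow part the signs of `v` make the term
exactly half the boundary norm (`transport_identity`, `transport_hypo`). The two first-order terms
add up to the integral of `∇z · N ∇z`, and the last term is a quadratic form of `M` in `∇z_v`; each
is bounded below by its minimum eigenvalue (`minEigenvalue_mul_normSq_le`). Moreover `λ₋(N) > 0`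
because `det N = ε M₁₂ - M₂₂²/4 > 0` and `M₁₂, ε > 0`. Traces are limits of smooth boundary values,
so Green's formula passes to the limit from smooth functions (`green_of_approx`). It also yields
uniqueness of lateral traces, needed because `trace` is a choice. -/

/-! ### Limits of integrals of products in `L²`. -/

theorem memLp_two_bdd_mul {α : Type*} [MeasurableSpace α] {μ : Measure α} {b f : α → ℝ} {C : ℝ}
    (hb : AEStronglyMeasurable b μ) (hC : ∀ᵐ x ∂μ, ‖b x‖ ≤ C) (hf : MemLp f 2 μ) :
    MemLp (fun x => b x * f x) 2 μ := by
  refine hf.of_le_mul (c := C) (hb.mul hf.1) ?_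
  filter_upwards [hC] with x hx
  rw [norm_mul]
  gcongr

theorem memLp_two_of_eLpNorm_sub {α : Type*} [MeasurableSpace α] {μ : Measure α} {f g : α → ℝ}
    (hf : AEStronglyMeasurable f μ) (hg : MemLp g 2 μ) (h : eLpNorm (f - g) 2 μ < ⊤) :
    MemLp f 2 μ := by
  have h1 : MemLp (f - g) 2 μ := ⟨hf.sub hg.1, h⟩
  simpa using h1.add hg

/-- The integral is the inner product of the `L²` classes, which is jointly continuous. -/
theorem tendsto_integral_mul_of_memLp {α : Type*} [MeasurableSpace α] {μ : Measure α}
    {f h : α → ℝ} {F H : ℕ → α → ℝ} (hf : MemLp f 2 μ) (hh : MemLp h 2 μ)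
    (hF : ∀ n, MemLp (F n) 2 μ) (hH : ∀ n, MemLp (H n) 2 μ)
    (hFf : Tendsto (fun n => eLpNorm (F n - f) 2 μ) atTop (𝓝 0))
    (hHh : Tendsto (fun n => eLpNorm (H n - h) 2 μ) atTop (𝓝 0)) :
    Tendsto (fun n => ∫ x, F n x * H n x ∂μ) atTop (𝓝 (∫ x, f x * h x ∂μ)) := by
  have key : ∀ {u w : α → ℝ} (hu : MemLp u 2 μ) (hw : MemLp w 2 μ),
      inner ℝ (hu.toLp u) (hw.toLp w) = ∫ x, u x * w x ∂μ := by
    intro u w hu hw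
    rw [L2.inner_def]
    refine integral_congr_ae ?_
    filter_upwards [hu.coeFn_toLp, hw.coeFn_toLp] with x h1 h2
    simp [h1, h2, mul_comm]
  have h1 := (Lp.tendsto_Lp_iff_tendsto_eLpNorm'' F hF f hf).2 hFf
  have h2 := (Lp.tendsto_Lp_iff_tendsto_eLpNorm'' H hH h hh).2 hHh
  have h3 := h1.inner (𝕜 := ℝ) h2
  simpa only [key] using h3

/-- Convergence of weighted integrals of products of `L²` convergent sequences. -/
theorem tendsto_integral_bdd_mul_mul {α : Type*} [MeasurableSpace α] {μ : Measure α}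
    {b f h : α → ℝ} {F H : ℕ → α → ℝ} {C : ℝ}
    (hb : AEStronglyMeasurable b μ) (hC : ∀ᵐ x ∂μ, ‖b x‖ ≤ C)
    (hf : MemLp f 2 μ) (hh : MemLp h 2 μ)
    (hF : ∀ n, AEStronglyMeasurable (F n) μ) (hH : ∀ n, AEStronglyMeasurable (H n) μ)
    (hFf : Tendsto (fun n => eLpNorm (F n - f) 2 μ) atTop (𝓝 0))
    (hHh : Tendsto (fun n => eLpNorm (H n - h) 2 μ) atTop (𝓝 0)) :
    Tendsto (fun n => ∫ x, b x * (F n x * H n x) ∂μ) atTop (𝓝 (∫ x, b x * (f x * h x) ∂μ)) := by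
  have e1 : ∀ᶠ n in atTop, eLpNorm (F n - f) 2 μ < 1 := hFf.eventually_lt_const one_pos
  have e2 : ∀ᶠ n in atTop, eLpNorm (H n - h) 2 μ < 1 := hHh.eventually_lt_const one_pos
  -- The first terms may lie outside `L²`; dropping them leaves terms at finite distance from the
  -- limit.
  obtain ⟨K, hK⟩ := eventually_atTop.1 (e1.and e2)
  have hFK : ∀ n, MemLp (F (n + K)) 2 μ := fun n =>
    memLp_two_of_eLpNorm_sub (hF _) hf ((hK _ (by omega)).1.trans ENNReal.one_lt_top)
  have hHK : ∀ n, MemLp (H (n + K)) 2 μ := fun n =>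
    memLp_two_of_eLpNorm_sub (hH _) hh ((hK _ (by omega)).2.trans ENNReal.one_lt_top)
  rw [← tendsto_add_atTop_iff_nat K]
  simp only [← mul_assoc]
  refine tendsto_integral_mul_of_memLp (F := fun n x => b x * F (n + K) x)
    (H := fun n => H (n + K)) (memLp_two_bdd_mul hb hC hf) hh (fun n => memLp_two_bdd_mul hb hC (hFK n)) hHK
    ?_ ((tendsto_add_atTop_iff_nat K).2 hHh)
  have h0 : Tendsto (fun n => ENNReal.ofReal C * eLpNorm (F (n + K) - f) 2 μ) atTop (𝓝 0) := by
    have := ENNReal.Tendsto.const_mul ((tendsto_add_atTop_iff_nat K).2 hFf)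
      (Or.inr (ENNReal.ofReal_ne_top (r := C)))
    simpa using this
  refine tendsto_of_tendsto_of_tendsto_of_le_of_le tendsto_const_nhds h0 (fun _ => zero_le) ?_
  intro n
  refine eLpNorm_le_mul_eLpNorm_of_ae_le_mul ?_ 2
  filter_upwards [hC] with x hx
  simp only [Pi.sub_apply, ← mul_sub, norm_mul]
  gcongr

/-! ### The rectangle and classical derivatives. -/

instance isFiniteMeasure_domainMeasure (X : ℝ) : IsFiniteMeasure (domainMeasure X) := by
  refine ⟨?_⟩
  rw [domainMeasure, Measure.restrict_apply_univ, domain, Measure.volume_eq_prod,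
    Measure.prod_prod]
  simp [ENNReal.mul_lt_top_iff]

theorem isOpen_domain (X : ℝ) : IsOpen (domain X) := isOpen_Ioo.prod isOpen_Ioo

theorem measurableSet_domain (X : ℝ) : MeasurableSet (domain X) := (isOpen_domain X).measurableSet

theorem exists_bound_domain (X : ℝ) {b : ℝ × ℝ → ℝ} (hb : Continuous b) :
    ∃ C, ∀ᵐ p ∂domainMeasure X, ‖b p‖ ≤ C := by
  obtain ⟨C, hC⟩ := (isCompact_Icc.prod isCompact_Icc :
    IsCompact (Icc (-X) X ×ˢ Icc (-1 : ℝ) 1)).exists_bound_of_continuousOn hb.continuousOn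
  refine ⟨C, (ae_restrict_iff' (measurableSet_domain X)).2 (.of_forall fun p hp => hC p ?_)⟩
  exact ⟨Ioo_subset_Icc_self hp.1, Ioo_subset_Icc_self hp.2⟩

theorem contDiff_classicalD (i : Fin 2) {φ : ℝ × ℝ → ℝ} (hφ : ContDiff ℝ ∞ φ) :
    ContDiff ℝ ∞ (classicalD i φ) :=
  (hφ.fderiv_right (m := ∞) (by simp)).clm_apply contDiff_const

theorem classicalD_comm {φ : ℝ × ℝ → ℝ} (hφ : ContDiff ℝ ∞ φ) (i j : Fin 2) :
    classicalD i (classicalD j φ) = classicalD j (classicalD i φ) := by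
  have key : ∀ (i j : Fin 2) p, classicalD i (classicalD j φ) p
      = fderiv ℝ (fderiv ℝ φ) p ((![(1, 0), (0, 1)] : Fin 2 → ℝ × ℝ) i)
        ((![(1, 0), (0, 1)] : Fin 2 → ℝ × ℝ) j) := by
    intro i j p
    have hd : DifferentiableAt ℝ (fderiv ℝ φ) p :=
      (hφ.fderiv_right (m := ∞) (by simp)).differentiable (by simp) p
    have h1 : HasFDerivAt (classicalD j φ) _ p :=
      hd.hasFDerivAt.clm_apply (hasFDerivAt_const ((![(1, 0), (0, 1)] : Fin 2 → ℝ × ℝ) j) p)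
    rw [classicalD, h1.fderiv]
    simp
  funext p
  rw [key, key]
  exact (hφ.contDiffAt.isSymmSndFDerivAt (by simpa using WithTop.coe_le_coe.2 (le_top : (2 : ℕ∞) ≤ ⊤))) _ _

/-! ### Green's formula in `x` and lateral traces. -/

/-- The fundamental theorem of calculus in the `x` direction, integrated over the rectangle. -/
theorem integral_classicalD_zero {X : ℝ} (hX : 0 < X) {F : ℝ × ℝ → ℝ} (hF : ContDiff ℝ ∞ F) :
    ∫ p in domain X, classicalD 0 F p = ∫ v in Ioo (-1 : ℝ) 1, (F (X, v) - F (-X, v)) := by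
  have hc : Continuous (classicalD 0 F) := (contDiff_classicalD 0 hF).continuous
  have hint : Integrable (classicalD 0 F) (domainMeasure X) := by
    obtain ⟨C, hC⟩ := exists_bound_domain X hc
    exact Integrable.of_bound hc.aestronglyMeasurable C hC
  have hm : (volume : Measure (ℝ × ℝ)).restrict (domain X)
      = (volume.restrict (Ioo (-X) X)).prod (volume.restrict (Ioo (-1) 1)) := by
    rw [domain, Measure.volume_eq_prod, Measure.prod_restrict]
  rw [domainMeasure, hm] at hint
  rw [hm, integral_prod_symm _ hint]
  refine integral_congr_ae (.of_forall fun v => ?_)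
  show ∫ x in Ioo (-X) X, classicalD 0 F (x, v) = _
  rw [← integral_Ioc_eq_integral_Ioo, ← intervalIntegral.integral_of_le (by linarith)]
  refine intervalIntegral.integral_eq_sub_of_hasDerivAt (f := fun x => F (x, v)) ?_
    (Continuous.intervalIntegrable (by fun_prop) _ _)
  intro x _
  have h1 : HasFDerivAt F (fderiv ℝ F (x, v)) (x, v) :=
    (hF.differentiable (by simp) (x, v)).hasFDerivAt
  have h2 : HasDerivAt (fun x : ℝ => (x, v)) ((1 : ℝ), (0 : ℝ)) x :=
    (hasDerivAt_id x).prodMk (hasDerivAt_const x v)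
  exact h1.comp_hasDerivAt x h2

theorem map_left_le_boundaryMeasure (X : ℝ) :
    (volume.restrict (Ioo (-1) 1)).map (fun v : ℝ => (-X, v)) ≤ boundaryMeasure X := by
  rw [boundaryMeasure, add_assoc, add_assoc]
  exact Measure.le_add_right le_rfl

theorem map_right_le_boundaryMeasure (X : ℝ) :
    (volume.restrict (Ioo (-1) 1)).map (fun v : ℝ => (X, v)) ≤ boundaryMeasure X := by
  rw [boundaryMeasure, add_assoc]
  exact Measure.le_add_right (Measure.le_add_left le_rfl)

theorem map_side_le_boundaryMeasure {X s : ℝ} (hs : s = X ∨ s = -X) :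
    (volume.restrict (Ioo (-1) 1)).map (fun v : ℝ => (s, v)) ≤ boundaryMeasure X := by
  rcases hs with rfl | rfl
  exacts [map_right_le_boundaryMeasure _, map_left_le_boundaryMeasure _]

theorem memLp_side {X s : ℝ} (hs : s = X ∨ s = -X) {g : ℝ × ℝ → ℝ}
    (hg : MemLp g 2 (boundaryMeasure X)) :
    MemLp (fun v => g (s, v)) 2 (volume.restrict (Ioo (-1 : ℝ) 1)) :=
  ((measurableEmbedding_prodMk_left s).memLp_map_measure_iff).1
    (hg.mono_measure (map_side_le_boundaryMeasure hs))

theorem eLpNorm_side_le {X s : ℝ} (hs : s = X ∨ s = -X) (g : ℝ × ℝ → ℝ) :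
    eLpNorm (fun v => g (s, v)) 2 (volume.restrict (Ioo (-1 : ℝ) 1))
      ≤ eLpNorm g 2 (boundaryMeasure X) := by
  refine le_trans (le_of_eq ?_) (eLpNorm_mono_measure g (map_side_le_boundaryMeasure hs))
  exact ((measurableEmbedding_prodMk_left s).eLpNorm_map_measure).symm

theorem tendsto_integral_side {X s : ℝ} (hs : s = X ∨ s = -X) {a g : ℝ × ℝ → ℝ}
    {φ : ℕ → ℝ × ℝ → ℝ} (ha : Continuous a) (hg : MemLp g 2 (boundaryMeasure X))
    (hφ : ∀ n, Continuous (φ n))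
    (h : Tendsto (fun n => eLpNorm (φ n - g) 2 (boundaryMeasure X)) atTop (𝓝 0)) :
    Tendsto (fun n => ∫ v in Ioo (-1 : ℝ) 1, a (s, v) * (φ n (s, v) * φ n (s, v))) atTop
      (𝓝 (∫ v in Ioo (-1 : ℝ) 1, a (s, v) * (g (s, v) * g (s, v)))) := by
  obtain ⟨C, hC⟩ := (isCompact_Icc (a := (-1 : ℝ)) (b := 1)).exists_bound_of_continuousOn
    (f := fun v => a (s, v)) (by fun_prop)
  have hl : Tendsto (fun n => eLpNorm ((fun v => φ n (s, v)) - fun v => g (s, v)) 2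
      (volume.restrict (Ioo (-1 : ℝ) 1))) atTop (𝓝 0) :=
    tendsto_of_tendsto_of_tendsto_of_le_of_le tendsto_const_nhds h (fun _ => zero_le)
      (fun n => eLpNorm_side_le hs (φ n - g))
  refine tendsto_integral_bdd_mul_mul (C := C) (F := fun n v => φ n (s, v))
    (H := fun n v => φ n (s, v)) (Continuous.aestronglyMeasurable (by fun_prop)) ?_
    (memLp_side hs hg) (memLp_side hs hg) ?_ ?_ hl hl
  · exact (ae_restrict_iff' measurableSet_Ioo).2
      (.of_forall fun v hv => hC v (Ioo_subset_Icc_self hv))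
  all_goals
    intro n
    have := hφ n
    exact Continuous.aestronglyMeasurable (by fun_prop)

/-- Green's formula in the `x` direction for limits of smooth functions. -/
theorem green_of_approx {X : ℝ} (hX : 0 < X) {a w w' g : ℝ × ℝ → ℝ} {φ : ℕ → ℝ × ℝ → ℝ}
    (ha : ContDiff ℝ ∞ a) (hw : MemLp w 2 (domainMeasure X)) (hw' : MemLp w' 2 (domainMeasure X))
    (hg : MemLp g 2 (boundaryMeasure X)) (hφ : ∀ n, ContDiff ℝ ∞ (φ n))
    (h0 : Tendsto (fun n => eLpNorm (φ n - w) 2 (domainMeasure X)) atTop (𝓝 0))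
    (h1 : Tendsto (fun n => eLpNorm (classicalD 0 (φ n) - w') 2 (domainMeasure X)) atTop (𝓝 0))
    (h2 : Tendsto (fun n => eLpNorm (φ n - g) 2 (boundaryMeasure X)) atTop (𝓝 0)) :
    (∫ p in domain X, classicalD 0 a p * (w p * w p)) + 2 * ∫ p in domain X, a p * (w p * w' p)
      = (∫ v in Ioo (-1 : ℝ) 1, a (X, v) * (g (X, v) * g (X, v)))
        - ∫ v in Ioo (-1 : ℝ) 1, a (-X, v) * (g (-X, v) * g (-X, v)) := by
  have hφc : ∀ n, Continuous (φ n) := fun n => (hφ n).continuous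
  have hφd : ∀ n, Continuous (classicalD 0 (φ n)) := fun n =>
    (contDiff_classicalD 0 (hφ n)).continuous
  have had := (contDiff_classicalD 0 ha).continuous
  obtain ⟨C, hC⟩ := exists_bound_domain X ha.continuous
  obtain ⟨C', hC'⟩ := exists_bound_domain X had
  have l1 := tendsto_integral_bdd_mul_mul had.aestronglyMeasurable hC' hw hw
    (fun n => (hφc n).aestronglyMeasurable) (fun n => (hφc n).aestronglyMeasurable) h0 h0
  have l2 := tendsto_integral_bdd_mul_mul ha.continuous.aestronglyMeasurable hC hw hw'
    (fun n => (hφc n).aestronglyMeasurable) (fun n => (hφd n).aestronglyMeasurable) h0 h1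
  have r1 := tendsto_integral_side (s := X) (.inl rfl) ha.continuous hg hφc h2
  have r2 := tendsto_integral_side (s := -X) (.inr rfl) ha.continuous hg hφc h2
  refine tendsto_nhds_unique (l1.add (l2.const_mul 2)) ((r1.sub r2).congr fun n => ?_)
  have hint : ∀ {b : ℝ × ℝ → ℝ}, Continuous b → Integrable b (domainMeasure X) := by
    intro b hb
    obtain ⟨K, hK⟩ := exists_bound_domain X hb
    exact Integrable.of_bound hb.aestronglyMeasurable K hK
  have hints : ∀ {b : ℝ → ℝ}, Continuous b → IntegrableOn b (Ioo (-1 : ℝ) 1) := fun hb =>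
    (hb.continuousOn.integrableOn_Icc).mono_set Ioo_subset_Icc_self
  have hcn := hφc n
  have hac := ha.continuous
  have hdn := hφd n
  -- For smooth `φ n`, the identity is the fundamental theorem of calculus for `a φ²`, whose
  -- `x`-derivative is `a_x φ² + 2 a φ φ_x`.
  have h3 := integral_classicalD_zero hX (ha.mul ((hφ n).mul (hφ n)))
  rw [integral_sub (hints (by fun_prop)) (hints (by fun_prop))] at h3
  rw [← h3, ← integral_const_mul, ← integral_add (hint (by fun_prop)) (hint (by fun_prop))]
  refine integral_congr_ae (.of_forall fun p => ?_)
  have da : HasFDerivAt a (fderiv ℝ a p) p := (ha.differentiable (by simp) p).hasFDerivAt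
  have df : HasFDerivAt (φ n) (fderiv ℝ (φ n) p) p :=
    ((hφ n).differentiable (by simp) p).hasFDerivAt
  have hd := (da.mul (df.mul df)).fderiv
  simp only [classicalD]
  erw [hd]
  simp
  ring

/-- The trace is unique on the lateral sides of the rectangle. -/
theorem HasTrace.ae_eq_side {X s : ℝ} (hX : 0 < X) (hs : s = X ∨ s = -X) {w g₁ g₂ : ℝ × ℝ → ℝ}
    (h₁ : HasTrace X w g₁) (h₂ : HasTrace X w g₂) :
    ∀ᵐ v ∂volume.restrict (Ioo (-1 : ℝ) 1), g₁ (s, v) = g₂ (s, v) := by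
  obtain ⟨hw, hg₁, φ, hφ, hφ0, hφ1, hφ2⟩ := h₁
  obtain ⟨-, hg₂, ψ, hψ, hψ0, hψ1, hψ2⟩ := h₂
  have hw0 : MemLp w 2 (domainMeasure X) := hw.1
  have hw1 : MemLp (weakD X 0 w) 2 (domainMeasure X) := (hw.2 0).2
  have hsub : ∀ {μ : Measure (ℝ × ℝ)} {F H : ℕ → ℝ × ℝ → ℝ} {f h : ℝ × ℝ → ℝ},
      (∀ n, AEStronglyMeasurable (F n) μ) → (∀ n, AEStronglyMeasurable (H n) μ) →
      AEStronglyMeasurable f μ → AEStronglyMeasurable h μ →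
      Tendsto (fun n => eLpNorm (F n - f) 2 μ) atTop (𝓝 0) →
      Tendsto (fun n => eLpNorm (H n - h) 2 μ) atTop (𝓝 0) →
      Tendsto (fun n => eLpNorm ((F n - H n) - (f - h)) 2 μ) atTop (𝓝 0) := by
    intro μ F H f h mF mH mf mh tF tH
    have := tF.add tH
    rw [add_zero] at this
    refine tendsto_of_tendsto_of_tendsto_of_le_of_le tendsto_const_nhds this
      (fun _ => zero_le) (fun n => ?_)
    simp only [show (F n - H n) - (f - h) = (F n - f) - (H n - h) by abel]
    exact eLpNorm_sub_le ((mF n).sub mf) ((mH n).sub mh) (by norm_num)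
  have mφ : ∀ n (μ : Measure (ℝ × ℝ)), AEStronglyMeasurable (φ n) μ := fun n μ =>
    (hφ n).continuous.aestronglyMeasurable
  have mψ : ∀ n (μ : Measure (ℝ × ℝ)), AEStronglyMeasurable (ψ n) μ := fun n μ =>
    (hψ n).continuous.aestronglyMeasurable
  have c0 := hsub (mφ · _) (mψ · _) hw0.1 hw0.1 hφ0 hψ0
  have c1 := hsub (fun n => (contDiff_classicalD 0 (hφ n)).continuous.aestronglyMeasurable)
    (fun n => (contDiff_classicalD 0 (hψ n)).continuous.aestronglyMeasurable) hw1.1 hw1.1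
    (hφ1 0) (hψ1 0)
  have c2 := hsub (mφ · _) (mψ · _) hg₁.1 hg₂.1 hφ2 hψ2
  have hD : ∀ n, classicalD 0 (φ n) - classicalD 0 (ψ n) = classicalD 0 (φ n - ψ n) := by
    intro n
    funext p
    simp only [classicalD, Pi.sub_apply]
    rw [fderiv_sub ((hφ n).differentiable (by simp) p) ((hψ n).differentiable (by simp) p)]
    rfl
  simp only [hD, sub_self] at c0 c1
  -- The approximants `φ n - ψ n` and their `x`-derivatives tend to zero, so only boundary terms of
  -- `g₁ - g₂` survive.
  have hgreen := fun (a : ℝ × ℝ → ℝ) (ha : ContDiff ℝ ∞ a) =>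
    green_of_approx hX ha MemLp.zero MemLp.zero (hg₁.sub hg₂)
      (fun n => (hφ n).sub (hψ n)) c0 c1 c2
  have hzero : ∫ v in Ioo (-1 : ℝ) 1, (g₁ - g₂) (s, v) * (g₁ - g₂) (s, v) = 0 := by
    rcases hs with rfl | rfl
    -- The weight vanishes on the opposite side and is a nonzero constant on the side considered,
    -- which isolates that side.
    · have := hgreen (fun p => p.1 + s) (by fun_prop)
      simp only [Pi.zero_apply, mul_zero, integral_zero, zero_add, neg_add_cancel, zero_mul,
        sub_zero] at this
      rw [integral_const_mul, eq_comm, mul_eq_zero] at this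
      exact this.resolve_left (by linarith)
    · have := hgreen (fun p => p.1 - X) (by fun_prop)
      simp only [Pi.zero_apply, mul_zero, integral_zero, zero_add, sub_self, zero_mul,
        zero_sub] at this
      rw [integral_const_mul, eq_comm, neg_eq_zero, mul_eq_zero] at this
      exact this.resolve_left (by linarith)
  have hL := memLp_side hs (hg₁.sub hg₂)
  have := (integral_eq_zero_iff_of_nonneg (fun v => mul_self_nonneg _)
    (hL.integrable_mul hL)).1 hzero
  filter_upwards [this] with v hv
  have := mul_self_eq_zero.1 hv
  simpa [sub_eq_zero] using this

/-! ### Calculus of weak derivatives. -/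

theorem hasWeakDeriv_weakD {X : ℝ} {i : Fin 2} {w : ℝ × ℝ → ℝ}
    (h : ∃ w', HasWeakDeriv X i w w') : HasWeakDeriv X i w (weakD X i w) := by
  rw [weakD, dif_pos h]
  exact h.choose_spec

theorem hasTrace_trace {X : ℝ} {w : ℝ × ℝ → ℝ} (h : ∃ g, HasTrace X w g) :
    HasTrace X w (trace X w) := by
  rw [trace, dif_pos h]
  exact h.choose_spec

theorem MemSobolev.memLp {X : ℝ} {m : ℕ} {w : ℝ × ℝ → ℝ} (h : MemSobolev X m w) :
    MemLp w 2 (domainMeasure X) := by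
  cases m with
  | zero => exact h
  | succ m => exact h.1

theorem MemSobolev.hasWeakDeriv {X : ℝ} {m : ℕ} {w : ℝ × ℝ → ℝ} (h : MemSobolev X (m + 1) w)
    (i : Fin 2) : HasWeakDeriv X i w (weakD X i w) := hasWeakDeriv_weakD (h.2 i).1

theorem MemSobolev.weakD {X : ℝ} {m : ℕ} {w : ℝ × ℝ → ℝ} (h : MemSobolev X (m + 1) w)
    (i : Fin 2) : MemSobolev X m (weakD X i w) := (h.2 i).2

theorem locallyIntegrableOn_of_memLp {X : ℝ} {w : ℝ × ℝ → ℝ} (h : MemLp w 2 (domainMeasure X)) :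
    LocallyIntegrableOn w (domain X) := by
  have : IntegrableOn w (domain X) := h.integrable (by norm_num)
  exact this.locallyIntegrableOn

theorem integrable_mul_of_memLp {X : ℝ} {w φ : ℝ × ℝ → ℝ} (h : MemLp w 2 (domainMeasure X))
    (hφ : Continuous φ) : IntegrableOn (fun p => w p * φ p) (domain X) := by
  obtain ⟨C, hC⟩ := exists_bound_domain X hφ
  simp only [mul_comm (w _)]
  exact (h.integrable (by norm_num)).bdd_mul hφ.aestronglyMeasurable hC

/-- The difference integrates to zero against every test function, so the fundamental lemma of the
calculus of variations applies. This identifies the chosen `weakD` with explicit candidates. -/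
theorem HasWeakDeriv.ae_eq {X : ℝ} {i : Fin 2} {w a b : ℝ × ℝ → ℝ}
    (ha : HasWeakDeriv X i w a) (hb : HasWeakDeriv X i w b)
    (ha2 : MemLp a 2 (domainMeasure X)) (hb2 : MemLp b 2 (domainMeasure X)) :
    a =ᵐ[domainMeasure X] b := by
  have h := (isOpen_domain X).ae_eq_zero_of_integral_contDiff_smul_eq_zero
    (locallyIntegrableOn_of_memLp (ha2.sub hb2)) (fun φ hφ hc hs => ?_)
  · rw [Filter.EventuallyEq, domainMeasure, ae_restrict_iff' (measurableSet_domain X)]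
    filter_upwards [h] with p hp hpd
    simpa [sub_eq_zero] using hp hpd
  · rw [← setIntegral_eq_integral_of_forall_compl_eq_zero (s := domain X)]
    · have e := (ha.2.2 φ hφ hc hs).symm.trans (hb.2.2 φ hφ hc hs)
      have e2 : ∫ p in domain X, (a p * φ p - b p * φ p) = 0 := by
        rw [integral_sub (integrable_mul_of_memLp ha2 hφ.continuous)
          (integrable_mul_of_memLp hb2 hφ.continuous)]
        linarith
      rw [← e2]
      refine integral_congr_ae (.of_forall fun p => ?_)
      simp only [Pi.sub_apply, smul_eq_mul]
      ring
    · intro p hp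
      rw [image_eq_zero_of_notMem_tsupport (fun h => hp (hs h)), zero_smul]

theorem HasWeakDeriv.linear_comb {X : ℝ} {i : Fin 2} {u u' w w' : ℝ × ℝ → ℝ} (c d : ℝ)
    (hu : HasWeakDeriv X i u u') (hw : HasWeakDeriv X i w w')
    (mu : MemLp u 2 (domainMeasure X)) (mu' : MemLp u' 2 (domainMeasure X))
    (mw : MemLp w 2 (domainMeasure X)) (mw' : MemLp w' 2 (domainMeasure X)) :
    HasWeakDeriv X i (fun p => c * u p + d * w p) (fun p => c * u' p + d * w' p) := by
  refine ⟨locallyIntegrableOn_of_memLp ((mu.const_mul c).add (mw.const_mul d)),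
    locallyIntegrableOn_of_memLp ((mu'.const_mul c).add (mw'.const_mul d)), fun φ hφ hc hs => ?_⟩
  have key : ∀ {f g ψ : ℝ × ℝ → ℝ}, MemLp f 2 (domainMeasure X) → MemLp g 2 (domainMeasure X) →
      Continuous ψ → ∫ p in domain X, (c * f p + d * g p) * ψ p
        = c * (∫ p in domain X, f p * ψ p) + d * ∫ p in domain X, g p * ψ p := by
    intro f g ψ hf hg hψ
    rw [← integral_const_mul, ← integral_const_mul,
      ← integral_add ((integrable_mul_of_memLp hf hψ).const_mul c)
        ((integrable_mul_of_memLp hg hψ).const_mul d)]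
    refine integral_congr_ae (.of_forall fun p => ?_)
    simp only []
    ring
  rw [key mu mw (contDiff_classicalD i hφ).continuous, key mu' mw' hφ.continuous,
    hu.2.2 φ hφ hc hs, hw.2.2 φ hφ hc hs]
  ring

/-- Weak second derivatives commute. -/
theorem HasWeakDeriv.comm {X : ℝ} {i j : Fin 2} {w wi wj wij : ℝ × ℝ → ℝ}
    (hi : HasWeakDeriv X i w wi) (hj : HasWeakDeriv X j w wj) (hij : HasWeakDeriv X j wi wij) :
    HasWeakDeriv X i wj wij := by
  refine ⟨hj.2.1, hij.2.1, fun φ hφ hc hs => ?_⟩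
  have hD : ∀ k, ContDiff ℝ ∞ (classicalD k φ) ∧ HasCompactSupport (classicalD k φ) ∧
      tsupport (classicalD k φ) ⊆ domain X := fun k =>
    ⟨contDiff_classicalD k hφ, hc.fderiv_apply (𝕜 := ℝ) _,
      (tsupport_fderiv_apply_subset ℝ _).trans hs⟩
  -- The derivatives of a test function are test functions: `w_j` is tested with `∂_i φ` and `w_i`
  -- with `∂_j φ`, and the classical mixed derivatives agree.
  have h1 := hj.2.2 _ (hD i).1 (hD i).2.1 (hD i).2.2
  have h2 := hi.2.2 _ (hD j).1 (hD j).2.1 (hD j).2.2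
  have h3 := hij.2.2 φ hφ hc hs
  rw [classicalD_comm hφ j i] at h1
  linarith

/-! ### Minimum eigenvalues. -/

/-- The spectrum is finite, and nonempty by the spectral theorem, so the infimum is attained. -/
theorem minEigenvalue_mem {A : Matrix (Fin 2) (Fin 2) ℝ} (hA : A.IsHermitian) :
    minEigenvalue A ∈ spectrum ℝ A := by
  refine Set.Nonempty.csInf_mem ?_ A.finite_spectrum
  rw [hA.spectrum_real_eq_range_eigenvalues]
  exact range_nonempty _

/-- Subtracting `λ₋(A)` times the identity shifts the spectrum into `[0, ∞)`, so the difference is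
positive semidefinite. -/
theorem minEigenvalue_mul_le {A : Matrix (Fin 2) (Fin 2) ℝ} (hA : A.IsHermitian)
    (u : Fin 2 → ℝ) : minEigenvalue A * (u ⬝ᵥ u) ≤ u ⬝ᵥ (A *ᵥ u) := by
  have hB : (A - algebraMap ℝ _ (minEigenvalue A)).PosSemidef := by
    rw [posSemidef_iff_isHermitian_and_spectrum_nonneg]
    refine ⟨hA.sub ?_, ?_⟩
    · rw [algebraMap_eq_diagonal]
      exact isHermitian_diagonal _
    · rw [← spectrum.sub_singleton_eq]
      rintro _ ⟨a, ha, b, rfl, rfl⟩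
      exact sub_nonneg.2 (csInf_le A.finite_spectrum.bddBelow ha)
  have h := hB.dotProduct_mulVec_nonneg u
  rw [sub_mulVec, dotProduct_sub, Algebra.algebraMap_eq_smul_one, smul_mulVec, one_mulVec,
    dotProduct_smul, smul_eq_mul] at h
  simpa using h

theorem isHermitian_matN (ε : ℝ) (M : Matrix (Fin 2) (Fin 2) ℝ) : (matN ε M).IsHermitian := by
  ext i j
  fin_cases i <;> fin_cases j <;> simp [matN]

/-- An eigenvalue `l` satisfies `(M₁₂ - l)(ε - l) = M₂₂²/4`. The condition forces `M₁₂ > 0`, so for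
`l ≤ 0` the left side is at least `ε M₁₂`, which is too large. -/
theorem minEigenvalue_matN_pos {ε : ℝ} {M : Matrix (Fin 2) (Fin 2) ℝ} (hε : 0 < ε)
    (h : M 1 1 ^ 2 < 4 * ε * M 0 1) : 0 < minEigenvalue (matN ε M) := by
  have h1 := minEigenvalue_mem (isHermitian_matN ε M)
  generalize minEigenvalue (matN ε M) = l at h1 ⊢
  rw [mem_spectrum_iff_isRoot_charpoly, Polynomial.IsRoot, eval_charpoly, det_fin_two] at h1
  simp [matN] at h1
  have hM : 0 < M 0 1 := by
    by_contra hc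
    nlinarith [sq_nonneg (M 1 1)]
  by_contra hc
  nlinarith [mul_nonneg (neg_nonneg.2 (not_lt.1 hc)) hM.le,
    mul_nonneg (neg_nonneg.2 (not_lt.1 hc)) hε.le]

/-! ### The inflow boundary and the transport term. -/

theorem measurableSet_inflow (X : ℝ) : MeasurableSet (inflow X) :=
  ((measurableSet_singleton _).prod measurableSet_Ico).union
    ((measurableSet_singleton _).prod measurableSet_Ioc)

theorem integrableOn_inflow {X : ℝ} {g : ℝ × ℝ → ℝ} (hg : MemLp g 2 (boundaryMeasure X)) :
    IntegrableOn (fun p => g p ^ 2 * |p.2|) (inflow X) (boundaryMeasure X) := by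
  simp only [mul_comm (_ ^ 2)]
  refine (hg.integrable_sq.integrableOn).bdd_mul (c := 1)
    (Continuous.aestronglyMeasurable (by fun_prop)) ?_
  refine (ae_restrict_iff' (measurableSet_inflow X)).2 (.of_forall fun p hp => ?_)
  rw [Real.norm_eq_abs, abs_abs, abs_le]
  rcases hp with hp | hp
  · exact ⟨by linarith [hp.2.1], hp.2.2.le⟩
  · exact ⟨hp.2.1.le, by linarith [hp.2.2]⟩

/-- The horizontal sides drop out because `v = ±1` never occurs on the inflow boundary. -/
theorem restrict_inflow {X : ℝ} (hX : 0 < X) :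
    (boundaryMeasure X).restrict (inflow X) =
      (volume.restrict (Ico 0 1)).map (fun v : ℝ => (-X, v)) +
      (volume.restrict (Ioc (-1) 0)).map (fun v : ℝ => (X, v)) := by
  have hne : -X ≠ X := by linarith
  have e1 : (fun v : ℝ => (-X, v)) ⁻¹' inflow X = Ico 0 1 := by
    ext v; simp [inflow, hne]
  have e2 : (fun v : ℝ => (X, v)) ⁻¹' inflow X = Ioc (-1) 0 := by
    ext v; simp [inflow, hne.symm]
  have e3 : (fun x : ℝ => (x, (-1 : ℝ))) ⁻¹' inflow X = ∅ := by
    ext v; simp [inflow]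
  have e4 : (fun x : ℝ => (x, (1 : ℝ))) ⁻¹' inflow X = ∅ := by
    ext v; simp [inflow]
  have i1 : Ico (0 : ℝ) 1 ∩ Ioo (-1) 1 = Ico 0 1 :=
    inter_eq_left.2 fun v hv => ⟨by linarith [hv.1], hv.2⟩
  have i2 : Ioc (-1 : ℝ) 0 ∩ Ioo (-1) 1 = Ioc (-1) 0 :=
    inter_eq_left.2 fun v hv => ⟨hv.1, by linarith [hv.2]⟩
  simp only [boundaryMeasure, Measure.restrict_add,
    (measurableEmbedding_prodMk_left _).restrict_map,
    (measurableEmbedding_prod_mk_right _).restrict_map]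
  rw [e1, e2, e3, e4, Measure.restrict_restrict measurableSet_Ico,
    Measure.restrict_restrict measurableSet_Ioc, i1, i2]
  simp

/-- On the inflow boundary `|v|` is `v` on the left and `-v` on the right, the signs that match
Green's formula. -/
theorem integral_inflow {X : ℝ} (hX : 0 < X) {g : ℝ × ℝ → ℝ}
    (hg : MemLp g 2 (boundaryMeasure X)) :
    ∫ p in inflow X, g p ^ 2 * |p.2| ∂boundaryMeasure X =
      (∫ v in Ico (0 : ℝ) 1, v * (g (-X, v) * g (-X, v)))
        - ∫ v in Ioc (-1 : ℝ) 0, v * (g (X, v) * g (X, v)) := by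
  have hi := integrableOn_inflow hg
  rw [IntegrableOn, restrict_inflow hX] at hi
  rw [restrict_inflow hX, integral_add_measure hi.left_of_add_measure hi.right_of_add_measure,
    (measurableEmbedding_prodMk_left _).integral_map,
    (measurableEmbedding_prodMk_left _).integral_map, sub_eq_add_neg, ← integral_neg]
  congr 1
  · refine setIntegral_congr_fun measurableSet_Ico fun v hv => ?_
    simp only [abs_of_nonneg hv.1]
    ring
  · refine setIntegral_congr_fun measurableSet_Ioc fun v hv => ?_
    simp only [abs_of_nonpos hv.2]
    ring

/-- `VanishesOn` speaks of some trace; uniqueness on the lateral sides carries the vanishing over to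
the chosen `trace`. -/
theorem VanishesOn.ae_side {X s : ℝ} (hX : 0 < X) (hs : s = X ∨ s = -X) {Γ : Set (ℝ × ℝ)}
    {w : ℝ × ℝ → ℝ} (h : VanishesOn X Γ w) :
    ∀ᵐ v ∂volume.restrict (Ioo (-1 : ℝ) 1), (s, v) ∈ Γ → trace X w (s, v) = 0 := by
  obtain ⟨g, hg, hΓ⟩ := h
  have h1 := ae_imp_of_ae_restrict hΓ
  have h2 := (measurableEmbedding_prodMk_left s).ae_map_iff.1
    (ae_mono (map_side_le_boundaryMeasure hs) h1)
  filter_upwards [h2, (hasTrace_trace ⟨g, hg⟩).ae_eq_side hX hs hg] with v h3 h4 hv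
  rw [h4, h3 hv]

/-- The transport term of a function whose trace vanishes on the outflow boundary. -/
theorem transport_identity {X : ℝ} (hX : 0 < X) {Γ : Set (ℝ × ℝ)} (hΓ : outflow X ⊆ Γ)
    {w : ℝ × ℝ → ℝ} (h : VanishesOn X Γ w) :
    -∫ p in domain X, p.2 * (w p * weakD X 0 w p)
      = 1 / 2 * ∫ p in inflow X, trace X w p ^ 2 * |p.2| ∂boundaryMeasure X := by
  have hT : HasTrace X w (trace X w) := hasTrace_trace (h.imp fun _ hg => hg.1)
  obtain ⟨hw, hg, φ, hφ, h0, h1, h2⟩ := hT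
  -- The weight is `v`, whose `x`-derivative is zero.
  have hgreen := green_of_approx hX contDiff_snd hw.memLp (hw.weakD 0).memLp hg hφ h0 (h1 0) h2
  have hD : ∀ p : ℝ × ℝ, classicalD 0 Prod.snd p = 0 := by
    intro p
    simp [classicalD, fderiv_snd]
  simp only [hD, zero_mul, integral_zero, zero_add] at hgreen
  -- On the right side `v > 0` is outflow, where the trace vanishes; on the left side this happens
  -- for `v < 0`.
  have er : ∫ v in Ioo (-1 : ℝ) 1, v * (trace X w (X, v) * trace X w (X, v))
      = ∫ v in Ioc (-1 : ℝ) 0, v * (trace X w (X, v) * trace X w (X, v)) := by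
    refine setIntegral_eq_of_subset_of_ae_sdiff_eq_zero measurableSet_Ioo.nullMeasurableSet
      (fun v hv => ⟨hv.1, by linarith [hv.2]⟩) ?_
    filter_upwards [ae_imp_of_ae_restrict (h.ae_side hX (s := X) (.inl rfl))] with v hv hvd
    have hpos : 0 < v := by
      by_contra hc
      exact hvd.2 ⟨hvd.1.1, not_lt.1 hc⟩
    rw [hv hvd.1 (hΓ (.inr ⟨rfl, hpos, hvd.1.2⟩))]
    simp
  have el : ∫ v in Ioo (-1 : ℝ) 1, v * (trace X w (-X, v) * trace X w (-X, v))
      = ∫ v in Ico (0 : ℝ) 1, v * (trace X w (-X, v) * trace X w (-X, v)) := by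
    refine setIntegral_eq_of_subset_of_ae_sdiff_eq_zero measurableSet_Ioo.nullMeasurableSet
      (fun v hv => ⟨by linarith [hv.1], hv.2⟩) ?_
    filter_upwards [ae_imp_of_ae_restrict (h.ae_side hX (s := -X) (.inr rfl))] with v hv hvd
    have hneg : v < 0 := by
      by_contra hc
      exact hvd.2 ⟨not_lt.1 hc, hvd.1.2⟩
    rw [hv hvd.1 (hΓ (.inl ⟨rfl, hvd.1.1, hneg⟩))]
    simp
  rw [er, el] at hgreen
  rw [integral_inflow hX hg]
  linarith

/-! ### The operator `ℋ` and its transport term. -/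

open scoped MatrixOrder in
theorem hypo_succ (X : ℝ) (M : Matrix (Fin 2) (Fin 2) ℝ) (w : ℝ × ℝ → ℝ) (p : ℝ × ℝ)
    (k : Fin 2) : hypo X M w p k.succ
      = CFC.sqrt M k 0 * weakD X 0 w p + CFC.sqrt M k 1 * weakD X 1 w p := by
  have h : hypo X M w p k.succ = (CFC.sqrt M *ᵥ grad X w p) k := rfl
  rw [h, mulVec, dotProduct, Fin.sum_univ_two]
  rfl

theorem memLp_hypo {X : ℝ} (M : Matrix (Fin 2) (Fin 2) ℝ) {w : ℝ × ℝ → ℝ} {m : ℕ}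
    (hw : MemSobolev X (m + 1) w) (j : Fin 3) :
    MemLp (fun p => hypo X M w p j) 2 (domainMeasure X) := by
  cases j using Fin.cases with
  | zero => exact hw.memLp
  | succ k =>
    simp only [hypo_succ]
    exact ((hw.weakD 0).memLp.const_mul _).add ((hw.weakD 1).memLp.const_mul _)

/-- `ℋ` commutes with the weak derivative in `x`. -/
theorem weakD_hypo_ae_eq {X : ℝ} (M : Matrix (Fin 2) (Fin 2) ℝ) {z : ℝ × ℝ → ℝ}
    (hz : MemSobolev X 2 z) (j : Fin 3) (h : MemSobolev X 1 fun p => hypo X M z p j) :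
    (weakD X 0 fun p => hypo X M z p j)
      =ᵐ[domainMeasure X] fun p => hypo X M (weakD X 0 z) p j := by
  cases j using Fin.cases with
  | zero => exact .rfl
  | succ k =>
    refine HasWeakDeriv.ae_eq (h.hasWeakDeriv 0) ?_ (h.weakD 0).memLp
      (memLp_hypo M (hz.weakD 0) _)
    simp only [hypo_succ]
    have hx := hz.weakD 0
    have hv := hz.weakD 1
    -- `ℋ z_x` contains `(z_x)_v`, whereas differentiating `ℋ z` in `x` produces `(z_v)_x`.
    have hc : HasWeakDeriv X 0 (weakD X 1 z) (weakD X 1 (weakD X 0 z)) :=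
      (hz.hasWeakDeriv 0).comm (hz.hasWeakDeriv 1) (hx.hasWeakDeriv 1)
    exact (hx.hasWeakDeriv 0).linear_comb _ _ hc hx.memLp (hx.weakD 0).memLp hv.memLp
      (hx.weakD 1).memLp

theorem transport_hypo {X : ℝ} (hX : 0 < X) {M : Matrix (Fin 2) (Fin 2) ℝ} {z : ℝ × ℝ → ℝ}
    {Γ : Set (ℝ × ℝ)} (hΓ : outflow X ⊆ Γ) (hz : z ∈ H2Zero X M Γ) :
    -(∫ p in domain X, p.2 * (hypo X M (weakD X 0 z) p ⬝ᵥ hypo X M z p))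
      = 1 / 2 * hypoBoundaryNormSq X M (inflow X) z := by
  obtain ⟨hz2, hvan⟩ := hz
  have hT : ∀ j, HasTrace X (fun p => hypo X M z p j) (trace X fun p => hypo X M z p j) :=
    fun j => hasTrace_trace ((hvan j).imp fun _ hg => hg.1)
  obtain ⟨C, hC⟩ := exists_bound_domain X continuous_snd
  have hint : ∀ j, Integrable (fun p => p.2 * (hypo X M z p j * hypo X M (weakD X 0 z) p j))
      (volume.restrict (domain X)) := fun j =>
    ((memLp_hypo M hz2 j).integrable_mul (memLp_hypo M (hz2.weakD 0) j)).bdd_mul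
      continuous_snd.aestronglyMeasurable hC
  have e1 : ∫ p in domain X, p.2 * (hypo X M (weakD X 0 z) p ⬝ᵥ hypo X M z p)
      = ∑ j, ∫ p in domain X, p.2 * (hypo X M z p j * weakD X 0 (fun q => hypo X M z q j) p) := by
    have : ∀ j, ∫ p in domain X, p.2 * (hypo X M z p j * weakD X 0 (fun q => hypo X M z q j) p)
        = ∫ p in domain X, p.2 * (hypo X M z p j * hypo X M (weakD X 0 z) p j) := by
      intro j
      refine integral_congr_ae ?_
      -- Having a trace includes membership in `H¹`, so each component of `ℋ z` has a weak
      -- `x`-derivative in `L²`.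
      filter_upwards [weakD_hypo_ae_eq M hz2 j (hT j).1] with p hp
      rw [hp]
    simp only [this]
    rw [← integral_finsetSum _ fun j _ => hint j]
    refine integral_congr_ae (.of_forall fun p => ?_)
    simp only [dotProduct, Finset.mul_sum, mul_comm (hypo X M (weakD X 0 z) p _)]
  have e2 : hypoBoundaryNormSq X M (inflow X) z
      = ∑ j, ∫ p in inflow X, trace X (fun q => hypo X M z q j) p ^ 2 * |p.2|
          ∂boundaryMeasure X := by
    rw [hypoBoundaryNormSq, ← integral_finsetSum _ fun j _ => integrableOn_inflow (hT j).2.1]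
    simp only [Finset.sum_mul]
  rw [e1, e2, ← Finset.sum_neg_distrib, Finset.mul_sum]
  exact Finset.sum_congr rfl fun j _ => transport_identity hX hΓ (hvan j)

/-! ### Quadratic forms in the gradient and the final estimate. -/

theorem integrable_grad_quadratic {X : ℝ} (A : Matrix (Fin 2) (Fin 2) ℝ) {w : ℝ × ℝ → ℝ}
    {m : ℕ} (hw : MemSobolev X (m + 1) w) :
    Integrable (fun p => grad X w p ⬝ᵥ (A *ᵥ grad X w p)) (domainMeasure X) := by
  simp only [dotProduct, mulVec, Finset.mul_sum]
  refine integrable_finsetSum _ fun i _ => integrable_finsetSum _ fun j _ => ?_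
  have := ((hw.weakD i).memLp.integrable_mul (hw.weakD j).memLp).const_mul (A i j)
  refine this.congr (.of_forall fun p => ?_)
  simp only [grad, Pi.mul_apply]
  ring

theorem minEigenvalue_mul_normSq_le {X : ℝ} {A : Matrix (Fin 2) (Fin 2) ℝ} (hA : A.IsHermitian)
    {w : ℝ × ℝ → ℝ} {m : ℕ} (hw : MemSobolev X (m + 1) w) :
    minEigenvalue A * normSq X (grad X w)
      ≤ ∫ p in domain X, grad X w p ⬝ᵥ (A *ᵥ grad X w p) := by
  rw [normSq, ← integral_const_mul]
  refine integral_mono ?_ (integrable_grad_quadratic A hw) fun p => minEigenvalue_mul_le hA _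
  -- The identity matrix gives the integrability of `|∇w|²`.
  have := integrable_grad_quadratic 1 hw
  simp only [one_mulVec] at this
  exact this.const_mul _

end Kolmogorov

theorem mainTheorem7 (X ε : ℝ) (hX : 0 < X) (hε : 0 < ε)
    (M : Matrix (Fin 2) (Fin 2) ℝ) (hM : M.PosSemidef) (hM_nonneg : ∀ i j, 0 ≤ M i j)
    (hM_cond : M 1 1 ^ 2 < 4 * ε * M 0 1)
    (z : ℝ × ℝ → ℝ)
    (hz : z ∈ Kolmogorov.H2Zero X M (Kolmogorov.outflow X ∪ Kolmogorov.parabolic X)) :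
    0 < Kolmogorov.minEigenvalue (Kolmogorov.matN ε M) ∧
    Kolmogorov.adjointForm X ε M z z ≥
      1 / 2 * Kolmogorov.hypoBoundaryNormSq X M (Kolmogorov.inflow X) z
      + Kolmogorov.minEigenvalue (Kolmogorov.matN ε M) * Kolmogorov.normSq X (Kolmogorov.grad X z)
      + ε * Kolmogorov.minEigenvalue M
        * Kolmogorov.normSq X (Kolmogorov.grad X (Kolmogorov.weakD X 1 z)) := by
  open MeasureTheory Matrix Kolmogorov in
  refine ⟨minEigenvalue_matN_pos hε hM_cond, ?_⟩
  have h1 := transport_hypo hX Set.subset_union_left hz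
  have hz2 : MemSobolev X 2 z := hz.1
  have h2 := minEigenvalue_mul_normSq_le (isHermitian_matN ε M) hz2
  have h3 := mul_le_mul_of_nonneg_left
    (minEigenvalue_mul_normSq_le hM.isHermitian (hz2.weakD 1)) hε.le
  have hx := (hz2.weakD 0).memLp
  have hv := (hz2.weakD 1).memLp
  -- The two off-diagonal entries `M₂₂/2` of `N` together give the mixed term `M₂₂ z_v z_x`.
  have h4 : ∫ p in domain X, grad X z p ⬝ᵥ (matN ε M *ᵥ grad X z p)
      = (∫ p in domain X, (M 0 1 * weakD X 0 z p + M 1 1 * weakD X 1 z p) * weakD X 0 z p)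
        + ε * ∫ p in domain X, weakD X 1 z p * weakD X 1 z p := by
    have i1 : IntegrableOn
        (fun p => (M 0 1 * weakD X 0 z p + M 1 1 * weakD X 1 z p) * weakD X 0 z p) (domain X) :=
      ((hx.const_mul _).add (hv.const_mul _)).integrable_mul hx
    have i2 : IntegrableOn (fun p => weakD X 1 z p * weakD X 1 z p) (domain X) :=
      hv.integrable_mul hv
    rw [← integral_const_mul, ← integral_add i1 (i2.const_mul ε)]
    refine integral_congr_ae (.of_forall fun p => ?_)
    simp [grad, matN, mulVec, dotProduct, Fin.sum_univ_two]
    ring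
  rw [h4] at h2
  rw [adjointForm, h1]
  linarith
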